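/- Let $X$ be a quasi-complete Hausdorff locally convex space over $\mathbb C$ (every closed bounded subset is complete), and let $(T(t))_{t\ge 0}$ be a family of continuous linear operators on $X$ such that $T(0)=\mathrm{id}$, $T(t+s)=T(t)T(s)$ for all $t,s\ge 0$, and * (strong continuity) $t\mapsto T(t)x$ is continuous on $[0,\infty)$ for every $x\in X$; * (local equicontinuity) for every continuous seminorm $q$ on $X$ and every $t_0\ge 0$ there are a continuous seminorm $p$ on $X$ and $C\ge 0$ with $q(T(t)x)\le C\,p(x)$ for all $t\in[0,t_0]$, $x\in X$; * (periodicity) $T(t_0)=\mathrm{id}$ for some $t_0>0$, and the period $\rho:=\inf\{t_0>0 : T(t_0)=\mathrm{id}\}$ satisfies $\rho>0$. Let $(A,D(A))$ be the generator: $D(A)$ is the set of $x\in X$ for which $Ax:=\lim_{t\to0+}\frac{T(t)x-x}{t}$ exists in $X$; and $D(A^2)=\{x\in D(A): Ax\in D(A)\}$. For $n\in\mathbb Z$ put $\mu_n:=\frac{2\pi i n}{\rho}$. Then for all $n\in\mathbb Z$ and $x\in X$ the Riemann integral in $$P_nx:=\frac1\rho\int_0^\rho e^{-\mu_n s}T(s)x\,ds$$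 exists in $X$, each $P_n$ is a continuous linear operator on $X$, and, with all sums over $\mathbb Z$ understood as limits in $X$ of the net of finite partial sums (unconditional summability), $$x=\sum_{n\in\mathbb Z}P_nx\quad (x\in D(A)),$$ $$T(t)x=\sum_{n\in\mathbb Z}e^{\mu_n t}P_nx\quad (x\in D(A),\ t\ge 0),$$ $$Ax=\sum_{n\in\mathbb Z}\mu_nP_nx\quad (x\in D(A^2)).$$ -/

import Mathlib

open Filter Topology
open scoped NNReal

namespace OpSemigroup

section Basic

variable {X : Type*} [AddCommGroup X] [Module ℂ X] [TopologicalSpace X]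

/-- The family `(T(t))_{t ≥ 0}` of continuous linear operators is a semigroup. -/
structure IsSemigroup (T : ℝ≥0 → X →L[ℂ] X) : Prop where
  map_zero : T 0 = ContinuousLinearMap.id ℂ X
  map_add : ∀ t s : ℝ≥0, T (t + s) = (T t).comp (T s)

/-- Strong continuity: every orbit `t ↦ T(t) x` is continuous on `[0, ∞)`. -/
def IsStronglyContinuous (T : ℝ≥0 → X →L[ℂ] X) : Prop :=
  ∀ x : X, Continuous fun t : ℝ≥0 => T t x

/-- Local equicontinuity, with respect to the fundamental system of all continuous seminorms
of the locally convex space `X`. -/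
def IsLocallyEquicontinuous (T : ℝ≥0 → X →L[ℂ] X) : Prop :=
  ∀ q : Seminorm ℂ X, Continuous q → ∀ t₀ : ℝ≥0,
    ∃ p : Seminorm ℂ X, Continuous p ∧ ∃ C : ℝ, 0 ≤ C ∧
      ∀ t : ℝ≥0, t ≤ t₀ → ∀ x : X, q (T t x) ≤ C * p x

/-- The semigroup is periodic: `T(t₀) = id` for some `t₀ > 0`. -/
def IsPeriodic (T : ℝ≥0 → X →L[ℂ] X) : Prop :=
  ∃ t₀ : ℝ≥0, 0 < t₀ ∧ T t₀ = ContinuousLinearMap.id ℂ X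

/-- The (minimal) period `inf {t₀ > 0 | T(t₀) = id}`. -/
noncomputable def period (T : ℝ≥0 → X →L[ℂ] X) : ℝ≥0 :=
  sInf {t₀ : ℝ≥0 | 0 < t₀ ∧ T t₀ = ContinuousLinearMap.id ℂ X}

/-- `(T(t) x - x) / t → y` as `t → 0+`. -/
def HasRightDerivZero (T : ℝ≥0 → X →L[ℂ] X) (x y : X) : Prop :=
  Tendsto (fun t : ℝ≥0 => ((t : ℝ) : ℂ)⁻¹ • (T t x - x)) (𝓝[>] (0 : ℝ≥0)) (𝓝 y)

/-- `t 0 ≤ t 1 ≤ ⋯ ≤ t N` is a partition of `[a, b]` with tags `ξ i ∈ [t i, t (i + 1)]`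
and mesh less than `δ`. -/
structure IsTaggedPartition (a b δ : ℝ) (N : ℕ) (t ξ : ℕ → ℝ) : Prop where
  left : t 0 = a
  right : t N = b
  tag_mem : ∀ i < N, ξ i ∈ Set.Icc (t i) (t (i + 1))
  mesh : ∀ i < N, t (i + 1) - t i < δ

/-- `I` is the Riemann integral of `f` over `[a, b]`, `a ≤ b`: the limit of the Riemann sums as
the mesh of the tagged partitions tends to zero. -/
def HasRiemannIntegral (f : ℝ → X) (a b : ℝ) (I : X) : Prop :=
  a ≤ b ∧ ∀ U ∈ 𝓝 I, ∃ δ : ℝ, 0 < δ ∧ ∀ (N : ℕ) (t ξ : ℕ → ℝ),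
    IsTaggedPartition a b δ N t ξ →
      ∑ i ∈ Finset.range N, ((t (i + 1) - t i : ℝ) : ℂ) • f (ξ i) ∈ U

end Basic

section Generator

variable {X : Type*} [AddCommGroup X] [Module ℂ X] [TopologicalSpace X]
  [IsTopologicalAddGroup X] [ContinuousSMul ℂ X]

theorem HasRightDerivZero.add {T : ℝ≥0 → X →L[ℂ] X} {x y x' y' : X}
    (h : HasRightDerivZero T x y) (h' : HasRightDerivZero T x' y') :
    HasRightDerivZero T (x + x') (y + y') := by
  refine (Tendsto.add h h').congr fun t => ?_
  rw [← smul_add, map_add]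
  congr 1
  abel

theorem HasRightDerivZero.smul {T : ℝ≥0 → X →L[ℂ] X} {x y : X} (c : ℂ)
    (h : HasRightDerivZero T x y) : HasRightDerivZero T (c • x) (c • y) := by
  refine (Tendsto.const_smul h c).congr fun t => ?_
  rw [map_smul, ← smul_sub, smul_comm]

theorem HasRightDerivZero.zero (T : ℝ≥0 → X →L[ℂ] X) : HasRightDerivZero T 0 0 := by
  simpa [HasRightDerivZero] using tendsto_const_nhds

theorem nhdsGT_zero_neBot : (𝓝[>] (0 : ℝ≥0)).NeBot := inferInstance

theorem HasRightDerivZero.unique [T2Space X] {T : ℝ≥0 → X →L[ℂ] X} {x y y' : X}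
    (h : HasRightDerivZero T x y) (h' : HasRightDerivZero T x y') : y = y' :=
  haveI := nhdsGT_zero_neBot
  tendsto_nhds_unique h h'

/-- The generator `(A, D(A))`: `D(A)` consists of all `x` for which `lim_{t → 0+} (T(t)x - x)/t`
exists, and `A x` is this limit. -/
noncomputable def generator [T2Space X] (T : ℝ≥0 → X →L[ℂ] X) : X →ₗ.[ℂ] X where
  domain :=
    { carrier := {x | ∃ y, HasRightDerivZero T x y}
      add_mem' := fun ⟨y, hy⟩ ⟨y', hy'⟩ => ⟨y + y', hy.add hy'⟩
      zero_mem' := ⟨0, HasRightDerivZero.zero T⟩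
      smul_mem' := fun c _ ⟨y, hy⟩ => ⟨c • y, hy.smul c⟩ }
  toFun :=
    { toFun := fun x => Classical.choose x.2
      map_add' := fun x x' => (Classical.choose_spec (x + x').2).unique
        ((Classical.choose_spec x.2).add (Classical.choose_spec x'.2))
      map_smul' := fun c x => (Classical.choose_spec (c • x).2).unique
        ((Classical.choose_spec x.2).smul c) }

theorem generator_spec [T2Space X] (T : ℝ≥0 → X →L[ℂ] X) (x : (generator T).domain) :
    HasRightDerivZero T x (generator T x) :=
  Classical.choose_spec x.2

end Generator

/-- `μ_n = 2 π i n / ρ`. -/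
noncomputable def freq (ρ : ℝ≥0) (n : ℤ) : ℂ :=
  2 * (Real.pi : ℂ) * Complex.I * (n : ℂ) / ((ρ : ℝ) : ℂ)

end OpSemigroup

-- Every continuous seminorm on $X$ has the form $\|\pi(\cdot)\|$ for a continuous linear map $\pi$
-- into a Banach space, so integrals and identities in $X$ can be tested after composing with such
-- $\pi$; quasi-completeness is needed only to produce the integrals. For $x\in D(A)$, integration
-- by parts over a period gives $P_nAx=\mu_nP_nx$. For a functional $\ell$, the numbers $\ell\pi
-- P_nx$ are the Fourier coefficients of $s\mapsto\ell\pi T(s)x$. Cauchy–Schwarz, Bessel's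
-- inequality for $\ell\pi T(\cdot)Ax$ and $\sum_{n\ne0}|\mu_n|^{-2}<\infty$ bound their tails
-- uniformly in $\|\ell\|\le1$ (`norm_sub_sum_fourierCoeffOn_le`), and Hahn–Banach yields
-- unconditional convergence in each seminorm (`IsSemigroup.hasSum_spectralProjection`). The other
-- two series follow by applying $T(t)$, with $T(t)P_nx=e^{\mu_nt}P_nx$, and by expanding $Ax$
-- itself.

universe u

/-! ### Continuous seminorms and Banach spaces -/

open scoped ComplexOrder in
theorem LocallyConvexSpace.polynormableSpace_complex (X : Type*) [AddCommGroup X] [Module ℂ X]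
    [TopologicalSpace X] [IsTopologicalAddGroup X] [ContinuousSMul ℂ X]
    [LocallyConvexSpace ℝ X] : PolynormableSpace ℂ X := by
  have : ContinuousSMul ℝ X := IsScalarTower.continuousSMul ℂ
  have : LocallyConvexSpace ℂ X := ⟨fun x => by
    simpa only [convex_RCLike_iff_convex_real (K := ℂ)] using
      LocallyConvexSpace.convex_basis (𝕜 := ℝ) x⟩
  exact LocallyConvexSpace.toPolynormableSpace

/-- The space `X` with the topology of a single seminorm. -/
def SeminormSpace {X : Type*} [AddCommGroup X] [Module ℂ X] (_ : Seminorm ℂ X) : Type _ := X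

instance {X : Type*} [AddCommGroup X] [Module ℂ X] (q : Seminorm ℂ X) :
    AddCommGroup (SeminormSpace q) :=
  inferInstanceAs (AddCommGroup X)

instance {X : Type*} [AddCommGroup X] [Module ℂ X] (q : Seminorm ℂ X) :
    Module ℂ (SeminormSpace q) :=
  inferInstanceAs (Module ℂ X)

noncomputable instance {X : Type*} [AddCommGroup X] [Module ℂ X] (q : Seminorm ℂ X) :
    SeminormedAddCommGroup (SeminormSpace q) :=
  AddGroupSeminorm.toSeminormedAddCommGroup (E := SeminormSpace q) q.toAddGroupSeminorm

noncomputable instance {X : Type*} [AddCommGroup X] [Module ℂ X] (q : Seminorm ℂ X) :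
    NormedSpace ℂ (SeminormSpace q) where
  norm_smul_le c x := (map_smul_eq_mul q c x).le

/-- The Hausdorff completion of $(X,q)$ serves as $Y$; it also kills the kernel of $q$. -/
theorem Seminorm.exists_continuousLinearMap_norm_eq {X : Type u} [AddCommGroup X] [Module ℂ X]
    [TopologicalSpace X] [IsTopologicalAddGroup X] (q : Seminorm ℂ X) (hq : Continuous q) :
    ∃ (Y : Type u) (_ : NormedAddCommGroup Y) (_ : NormedSpace ℂ Y) (_ : CompleteSpace Y)
      (π : X →L[ℂ] Y), ∀ x, ‖π x‖ = q x := by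
  let e : X →ₗ[ℂ] SeminormSpace q :=
    LinearMap.id (R := ℂ) (M := X)
  have he : Continuous e := by
    refine continuous_of_continuousAt_zero e ?_
    rw [ContinuousAt, map_zero, tendsto_zero_iff_norm_tendsto_zero]
    simpa using! hq.tendsto 0
  let i : SeminormSpace q →L[ℂ] UniformSpace.Completion (SeminormSpace q) :=
    UniformSpace.Completion.toComplL
  refine ⟨UniformSpace.Completion (SeminormSpace q), inferInstance, inferInstance, inferInstance,
    i.comp ⟨e, he⟩, fun x => ?_⟩
  exact UniformSpace.Completion.norm_coe (e x)

section Convergence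

variable {X : Type*} [AddCommGroup X] [Module ℂ X] [UniformSpace X] [IsUniformAddGroup X]

theorem cauchySeq_of_seminorm_cauchySeq [PolynormableSpace ℂ X] {S : ℕ → X}
    (h : ∀ q : Seminorm ℂ X, Continuous q → ∀ ε > 0, ∃ K, ∀ m ≥ K, ∀ n ≥ K, q (S m - S n) < ε) :
    CauchySeq S := by
  rw [cauchySeq_iff_tendsto, uniformity_eq_comap_nhds_zero, tendsto_comap_iff,
    (PolynormableSpace.withSeminorms ℂ X).tendsto_nhds]
  intro q ε hε
  obtain ⟨K, hK⟩ := h q.1 q.2 ε hε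
  filter_upwards [eventually_ge_atTop (K, K)] with p hp
  simpa using hK p.2 hp.2 p.1 hp.1

/-- The range of a Cauchy sequence is totally bounded, so its closure is closed and bounded. -/
theorem CauchySeq.tendsto_of_quasiCompleteSpace [ContinuousSMul ℂ X] [QuasiCompleteSpace ℂ X]
    {S : ℕ → X} (h : CauchySeq S) : ∃ I, Tendsto S atTop (𝓝 I) := by
  have hc : IsComplete (closure (Set.range S)) :=
    QuasiCompleteSpace.quasiComplete (𝕜 := ℂ)
      (TotallyBounded.isVonNBounded ℂ h.totallyBounded_range.closure) isClosed_closure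
  obtain ⟨I, -, hI⟩ := cauchySeq_tendsto_of_isComplete hc
    (fun n => subset_closure (Set.mem_range_self n)) h
  exact ⟨I, hI⟩

end Convergence

/-! ### Riemann integrals of continuous functions -/

namespace OpSemigroup

theorem IsTaggedPartition.monotone {a b δ : ℝ} {N : ℕ} {t ξ : ℕ → ℝ}
    (h : IsTaggedPartition a b δ N t ξ) {i j : ℕ} (hij : i ≤ j) (hj : j ≤ N) : t i ≤ t j := by
  induction j, hij using Nat.le_induction with
  | base => rfl
  | succ j _ ih => exact (ih (by omega)).trans ((h.tag_mem j hj).1.trans (h.tag_mem j hj).2)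

theorem IsTaggedPartition.mem_Icc {a b δ : ℝ} {N : ℕ} {t ξ : ℕ → ℝ}
    (h : IsTaggedPartition a b δ N t ξ) {i : ℕ} (hi : i ≤ N) : t i ∈ Set.Icc a b := by
  constructor
  · simpa [h.left] using h.monotone (Nat.zero_le i) hi
  · simpa [h.right] using h.monotone hi le_rfl

theorem exists_riemannSum_near_integral {Y : Type*} [NormedAddCommGroup Y] [NormedSpace ℂ Y]
    [CompleteSpace Y] {a b : ℝ} (hab : a ≤ b) {f : ℝ → Y} (hf : ContinuousOn f (Set.Icc a b))
    {ε : ℝ} (hε : 0 < ε) :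
    ∃ δ : ℝ, 0 < δ ∧ ∀ (N : ℕ) (t ξ : ℕ → ℝ), IsTaggedPartition a b δ N t ξ →
      ‖∑ i ∈ Finset.range N, ((t (i + 1) - t i : ℝ) : ℂ) • f (ξ i) - ∫ s in a..b, f s‖ < ε := by
  have hu := isCompact_Icc.uniformContinuousOn_of_continuous hf
  rw [Metric.uniformContinuousOn_iff] at hu
  -- The summand $1$ covers $a=b$ and makes the final estimate strict.
  set η : ℝ := ε / (b - a + 1)
  have hη : 0 < η := div_pos hε (by linarith)
  obtain ⟨δ, hδ, H⟩ := hu η hη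
  refine ⟨δ, hδ, fun N t ξ h => ?_⟩
  have hle : ∀ i < N, t i ≤ t (i + 1) := fun i hi => h.monotone (Nat.le_succ i) hi
  have hint : ∀ i < N, IntervalIntegrable f MeasureTheory.volume (t i) (t (i + 1)) :=
    fun i hi => (hf.mono (by
      rw [Set.uIcc_of_le (hle i hi)]
      exact Set.Icc_subset_Icc (h.mem_Icc hi.le).1 (h.mem_Icc hi).2)).intervalIntegrable
  have hsum := intervalIntegral.sum_integral_adjacent_intervals hint
  rw [h.left, h.right] at hsum
  rw [← hsum, ← Finset.sum_sub_distrib]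
  have hterm : ∀ i ∈ Finset.range N,
      ‖((t (i + 1) - t i : ℝ) : ℂ) • f (ξ i) - ∫ s in t i..t (i + 1), f s‖
        ≤ η * (t (i + 1) - t i) := by
    intro i hi
    have hi := Finset.mem_range.1 hi
    have e : ((t (i + 1) - t i : ℝ) : ℂ) • f (ξ i) = ∫ _ in t i..t (i + 1), f (ξ i) := by
      rw [intervalIntegral.integral_const, Complex.coe_smul]
    rw [e, ← intervalIntegral.integral_sub (by simp) (hint i hi)]
    refine (intervalIntegral.norm_integral_le_of_norm_le_const (C := η) fun s hs => ?_).trans_eq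
      (by rw [abs_of_nonneg (sub_nonneg.2 (hle i hi))])
    rw [Set.uIoc_of_le (hle i hi)] at hs
    have htag := h.tag_mem i hi
    have hmesh := h.mesh i hi
    have h1 := h.mem_Icc hi.le
    have h2 := h.mem_Icc (Nat.succ_le_of_lt hi)
    rw [← dist_eq_norm]
    refine (H _ ⟨h1.1.trans htag.1, htag.2.trans h2.2⟩ _
      ⟨h1.1.trans hs.1.le, hs.2.trans h2.2⟩ ?_).le
    rw [Real.dist_eq, abs_lt]
    constructor <;> linarith [htag.1, htag.2, hs.1, hs.2]
  refine (norm_sum_le_of_le _ hterm).trans_lt ?_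
  rw [← Finset.mul_sum, Finset.sum_range_sub, h.left, h.right, div_mul_eq_mul_div,
    div_lt_iff₀ (by linarith)]
  nlinarith

theorem isTaggedPartition_uniform {a b δ : ℝ} (hab : a ≤ b) {k : ℕ} (hδ : (b - a) / (k + 1) < δ) :
    IsTaggedPartition a b δ (k + 1) (fun i => a + i * ((b - a) / (k + 1)))
      (fun i => a + i * ((b - a) / (k + 1))) := by
  have h0 : 0 ≤ (b - a) / ((k : ℝ) + 1) := div_nonneg (by linarith) (by positivity)
  refine ⟨by simp, ?_, fun i _ => ⟨le_rfl, ?_⟩, fun i _ => ?_⟩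
  · push_cast
    field_simp
    ring
  · push_cast
    linarith
  · push_cast
    linarith

section Integral

variable {X : Type u} [AddCommGroup X] [Module ℂ X] [UniformSpace X] [IsUniformAddGroup X]
  [ContinuousSMul ℂ X] [PolynormableSpace ℂ X] [QuasiCompleteSpace ℂ X]

/-- Uniform partitions give a Cauchy sequence of Riemann sums, whose limit is the candidate.
Arbitrary partitions are then compared with it through the Bochner integral in $Y$. -/
theorem exists_hasRiemannIntegral {a b : ℝ} (hab : a ≤ b) {f : ℝ → X}
    (hf : ContinuousOn f (Set.Icc a b)) :
    ∃ I : X, HasRiemannIntegral f a b I ∧ ∀ (Y : Type u) [NormedAddCommGroup Y] [NormedSpace ℂ Y]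
      [CompleteSpace Y] (π : X →L[ℂ] Y), π I = ∫ s in a..b, π (f s) := by
  let t : ℕ → ℕ → ℝ := fun k i => a + i * ((b - a) / (k + 1))
  let S : ℕ → X := fun k =>
    ∑ i ∈ Finset.range (k + 1), ((t k (i + 1) - t k i : ℝ) : ℂ) • f (t k i)
  have hS : ∀ (Y : Type u) [NormedAddCommGroup Y] [NormedSpace ℂ Y] [CompleteSpace Y]
      (π : X →L[ℂ] Y), Tendsto (fun k => π (S k)) atTop (𝓝 (∫ s in a..b, π (f s))) := by
    intro Y _ _ _ π
    rw [Metric.tendsto_nhds]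
    intro ε hε
    obtain ⟨δ, hδ, H⟩ :=
      exists_riemannSum_near_integral hab (π.continuous.comp_continuousOn hf) hε
    have hmesh : ∀ᶠ k : ℕ in atTop, (b - a) / ((k : ℝ) + 1) < δ :=
      (tendsto_const_nhds.div_atTop
        (tendsto_atTop_add_const_right _ 1 tendsto_natCast_atTop_atTop)).eventually_lt_const hδ
    filter_upwards [hmesh] with k hk
    have := H _ _ _ (isTaggedPartition_uniform hab hk)
    simpa [S, t, dist_eq_norm, map_sum, map_smul] using this
  have hC : CauchySeq S := by
    refine cauchySeq_of_seminorm_cauchySeq fun q hq ε hε => ?_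
    obtain ⟨Y, _, _, _, π, hπ⟩ := q.exists_continuousLinearMap_norm_eq hq
    obtain ⟨K, hK⟩ := Metric.cauchySeq_iff.1 (hS Y π).cauchySeq ε hε
    exact ⟨K, fun m hm n hn => by
      simpa only [dist_eq_norm, ← map_sub, hπ] using hK m hm n hn⟩
  obtain ⟨I, hI⟩ := hC.tendsto_of_quasiCompleteSpace
  have hπI : ∀ (Y : Type u) [NormedAddCommGroup Y] [NormedSpace ℂ Y]
      [CompleteSpace Y] (π : X →L[ℂ] Y), π I = ∫ s in a..b, π (f s) := fun Y _ _ _ π =>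
    tendsto_nhds_unique ((π.continuous.tendsto I).comp hI) (hS Y π)
  refine ⟨I, ⟨hab, fun U hU => ?_⟩, hπI⟩
  obtain ⟨s, r, hr, hU⟩ := ((PolynormableSpace.withSeminorms ℂ X).mem_nhds_iff I U).1 hU
  -- A finite supremum of continuous seminorms is again one, so a single $\pi$ controls the
  -- neighbourhood.
  set q : Seminorm ℂ X := s.sup fun p : {p : Seminorm ℂ X // Continuous p} => p.1
  have hq : Continuous q := Seminorm.continuous_finsetSup fun p _ => p.2
  obtain ⟨Y, _, _, _, π, hπ⟩ := q.exists_continuousLinearMap_norm_eq hq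
  obtain ⟨δ, hδ, H⟩ := exists_riemannSum_near_integral hab (π.continuous.comp_continuousOn hf) hr
  refine ⟨δ, hδ, fun N t ξ h => hU ?_⟩
  rw [Seminorm.mem_ball, ← hπ, map_sub, hπI Y π]
  simpa [map_sum, map_smul] using H N t ξ h

end Integral

end OpSemigroup

/-! ### Fourier tail estimate -/

/-- Off $F$ one has $|\hat g|=|\mu|^{-1}|\hat h|$, so Cauchy–Schwarz and Bessel bound the tail. The
choice of $F$ and $ε$ depends on $μ$ alone, which gives uniformity over functionals. -/
theorem norm_sub_sum_fourierCoeffOn_le {r : ℝ} (hr : 0 < r) {g h : ℝ → ℂ}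
    (hg : ContinuousOn g (Set.Icc 0 r)) (hh : ContinuousOn h (Set.Icc 0 r)) (hper : g 0 = g r)
    {μ : ℤ → ℂ} (hc : ∀ n, fourierCoeffOn hr h n = μ n * fourierCoeffOn hr g n)
    (hμ : ∀ n ≠ 0, μ n ≠ 0) {M : ℝ} (hM : ∀ s ∈ Set.Icc 0 r, ‖h s‖ ≤ M) (hM0 : 0 ≤ M)
    {F : Finset ℤ} (h0 : 0 ∈ F) {ε : ℝ} (hε : 0 ≤ ε)
    (hF : ∀ G : Finset ℤ, Disjoint G F → ∑ n ∈ G, ‖μ n‖⁻¹ ^ 2 ≤ ε ^ 2) :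
    ‖g 0 - ∑ n ∈ F, fourierCoeffOn hr g n‖ ≤ ε * M := by
  have hparseval : HasSum (fun n => ‖fourierCoeffOn hr h n‖ ^ 2)
      ((r - 0)⁻¹ • ∫ x in (0 : ℝ)..r, ‖h x‖ ^ 2) := by
    refine hasSum_sq_fourierCoeffOn hr ?_
    refine MeasureTheory.MemLp.of_bound
      ((hh.mono Set.Ioc_subset_Icc_self).aestronglyMeasurable measurableSet_Ioc) M ?_
    filter_upwards [MeasureTheory.ae_restrict_mem measurableSet_Ioc] with s hs
    exact hM s (Set.Ioc_subset_Icc_self hs)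
  have hbessel : ∀ G : Finset ℤ, ∑ n ∈ G, ‖fourierCoeffOn hr h n‖ ^ 2 ≤ M ^ 2 := by
    intro G
    refine (sum_le_hasSum G (fun _ _ => by positivity) hparseval).trans ?_
    have : ∫ x in (0 : ℝ)..r, ‖h x‖ ^ 2 ≤ ∫ _ in (0 : ℝ)..r, M ^ 2 := by
      refine intervalIntegral.integral_mono_on hr.le ?_ (by simp) fun s hs =>
        pow_le_pow_left₀ (norm_nonneg _) (hM s hs) 2
      exact ContinuousOn.intervalIntegrable (by rw [Set.uIcc_of_le hr.le]; exact hh.norm.pow 2)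
    rw [intervalIntegral.integral_const, sub_zero, smul_eq_mul] at this
    rw [sub_zero, smul_eq_mul, inv_mul_le_iff₀ hr]
    exact this
  have hnorm : ∀ n ≠ 0, ‖fourierCoeffOn hr g n‖ = ‖μ n‖⁻¹ * ‖fourierCoeffOn hr h n‖ := by
    intro n hn
    rw [hc, norm_mul, inv_mul_cancel_left₀ (norm_ne_zero_iff.2 (hμ n hn))]
  have htail : ∀ G : Finset ℤ, Disjoint G F → ∑ n ∈ G, ‖fourierCoeffOn hr g n‖ ≤ ε * M := by
    intro G hG
    have e : ∑ n ∈ G, ‖fourierCoeffOn hr g n‖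
        = ∑ n ∈ G, ‖μ n‖⁻¹ * ‖fourierCoeffOn hr h n‖ :=
      Finset.sum_congr rfl fun n hn => hnorm n fun h =>
        Finset.disjoint_left.1 hG hn (h ▸ h0)
    rw [e]
    refine abs_le_of_sq_le_sq' ?_ (by positivity) |>.2
    refine (Finset.sum_mul_sq_le_sq_mul_sq G _ _).trans ?_
    rw [mul_pow]
    exact mul_le_mul (hF G hG) (hbessel G) (by positivity) (by positivity)
  have hsummable : Summable (fourierCoeffOn hr g) := by
    refine (Finset.summable_compl_iff F).1 ?_
    refine Summable.of_norm (summable_of_sum_le (c := ε * M) (fun _ => norm_nonneg _) fun G => ?_)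
    have := htail (G.map (Function.Embedding.subtype _)) (by
      rw [Finset.disjoint_left]
      intro n hn
      obtain ⟨m, -, rfl⟩ := Finset.mem_map.1 hn
      exact m.2)
    simpa [Finset.sum_map] using this
  -- A continuous function on the circle with summable coefficients equals its Fourier series; at
  -- $0$ all characters are $1$.
  have hpoint : HasSum (fourierCoeffOn hr g) (g 0) := by
    have : Fact (0 < r) := ⟨hr⟩
    let φ : C(AddCircle r, ℂ) := ⟨AddCircle.liftIco r 0 g,
      AddCircle.liftIco_continuous (by simpa using hper) (by simpa using hg)⟩
    have hφ : fourierCoeff φ = fourierCoeffOn hr g := by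
      ext n
      have := fourierCoeff_liftIco_eq (T := r) (a := 0) g n
      simpa only [zero_add] using! this
    have := has_pointwise_sum_fourier_series_of_summable (f := φ) (hφ ▸ hsummable)
      ((0 : ℝ) : AddCircle r)
    rw [hφ] at this
    have e : φ ((0 : ℝ) : AddCircle r) = g 0 :=
      AddCircle.liftIco_coe_apply (by simpa using hr)
    rw [e] at this
    simpa using this
  have hlim : Tendsto (fun G : Finset ℤ => ‖∑ n ∈ G, fourierCoeffOn hr g n
      - ∑ n ∈ F, fourierCoeffOn hr g n‖) atTop (𝓝 ‖g 0 - ∑ n ∈ F, fourierCoeffOn hr g n‖) :=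
    (Tendsto.sub_const hpoint _).norm
  refine le_of_tendsto hlim ?_
  filter_upwards [eventually_ge_atTop F] with G hG
  rw [← Finset.sum_sdiff (f := fourierCoeffOn hr g) hG, add_sub_cancel_right]
  exact (norm_sum_le _ _).trans (htail _ Finset.sdiff_disjoint)

/-! ### Frequencies and periodic orbits -/

namespace OpSemigroup

theorem norm_exp_freq_mul (ρ : ℝ≥0) (n : ℤ) (t : ℝ) : ‖Complex.exp (freq ρ n * t)‖ = 1 := by
  have : freq ρ n * t = ((2 * Real.pi * n / ρ * t : ℝ) : ℂ) * Complex.I := by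
    simp only [freq]
    push_cast
    ring
  rw [this, Complex.norm_exp_ofReal_mul_I]

theorem norm_exp_neg_freq_mul (ρ : ℝ≥0) (n : ℤ) (t : ℝ) :
    ‖Complex.exp (-freq ρ n * t)‖ = 1 := by
  simpa using norm_exp_freq_mul ρ n (-t)

theorem exp_neg_freq_mul_period {ρ : ℝ≥0} (hρ : 0 < ρ) (n : ℤ) :
    Complex.exp (-freq ρ n * ((ρ : ℝ) : ℂ)) = 1 := by
  have h : ((ρ : ℝ) : ℂ) ≠ 0 := by exact_mod_cast hρ.ne'
  refine Complex.exp_eq_one_iff.2 ⟨-n, ?_⟩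
  simp only [freq]
  field_simp
  push_cast
  ring

theorem freq_ne_zero {ρ : ℝ≥0} (hρ : 0 < ρ) {n : ℤ} (hn : n ≠ 0) : freq ρ n ≠ 0 := by
  have h : ((ρ : ℝ) : ℂ) ≠ 0 := by exact_mod_cast hρ.ne'
  have := Complex.two_pi_I_ne_zero
  exact div_ne_zero (mul_ne_zero this (by exact_mod_cast hn)) h

theorem summable_norm_freq_inv_sq (ρ : ℝ≥0) : Summable fun n : ℤ => ‖freq ρ n‖⁻¹ ^ 2 := by
  have h := (Real.summable_one_div_int_pow (p := 2)).2 one_lt_two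
  refine (h.mul_left ((ρ / (2 * Real.pi)) ^ 2 : ℝ)).congr fun n => ?_
  have : ‖freq ρ n‖ = 2 * Real.pi * |(n : ℝ)| / ρ := by
    simp [freq, abs_of_pos Real.pi_pos]
  rw [this, inv_div, ← sq_abs (n : ℝ)]
  ring

theorem fourierCoeffOn_eq_freq {ρ : ℝ≥0} (hρ : (0 : ℝ) < ρ) (g : ℝ → ℂ) (n : ℤ) :
    fourierCoeffOn hρ g n
      = ((ρ : ℝ) : ℂ)⁻¹ • ∫ s in (0 : ℝ)..ρ, Complex.exp (-freq ρ n * s) • g s := by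
  rw [fourierCoeffOn_eq_integral, ← Complex.coe_smul]
  congr 1
  · simp
  · refine intervalIntegral.integral_congr fun s _ => ?_
    simp only [fourier_coe_apply, freq]
    congr 2
    push_cast
    ring

section Semigroup

variable {X : Type u} [AddCommGroup X] [Module ℂ X] [TopologicalSpace X]
  {T : ℝ≥0 → X →L[ℂ] X}

theorem apply_period_eq_id [T2Space X] (hcont : IsStronglyContinuous T)
    (hper : IsPeriodic T) : T (period T) = ContinuousLinearMap.id ℂ X := by
  obtain ⟨v, -, hv, hvS⟩ := exists_seq_tendsto_sInf
    (S := {t₀ : ℝ≥0 | 0 < t₀ ∧ T t₀ = ContinuousLinearMap.id ℂ X}) hper (OrderBot.bddBelow _)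
  ext x
  refine tendsto_nhds_unique (((hcont x).tendsto _).comp hv) ?_
  refine tendsto_const_nhds.congr fun n => ?_
  simp [(hvS n).2]

theorem IsSemigroup.apply_add (hT : IsSemigroup T) (t s : ℝ≥0) (x : X) :
    T (t + s) x = T t (T s x) := by
  rw [hT.map_add]; rfl

theorem IsStronglyContinuous.continuous_orbit (hcont : IsStronglyContinuous T) (x : X) :
    Continuous fun s : ℝ => T s.toNNReal x :=
  (hcont x).comp continuous_real_toNNReal

variable {Y : Type*} [NormedAddCommGroup Y] [NormedSpace ℂ Y] (π : X →L[ℂ] Y)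

/-- For $r>s$, $T(r)x-T(s)x=T(s)(T(r-s)x-x)$, so the right derivative at $0$ transports to $s$. -/
theorem IsSemigroup.hasDerivWithinAt_orbit (hT : IsSemigroup T) {x y : X}
    (h : HasRightDerivZero T x y) {s : ℝ} (hs : 0 ≤ s) :
    HasDerivWithinAt (fun s : ℝ => π (T s.toNNReal x)) (π (T s.toNNReal y)) (Set.Ioi s) s := by
  rw [hasDerivWithinAt_iff_tendsto_slope' Set.self_notMem_Ioi]
  have hlim : Tendsto (fun r : ℝ => (r - s).toNNReal) (𝓝[>] s) (𝓝[>] 0) := by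
    refine tendsto_nhdsWithin_iff.2 ⟨?_, ?_⟩
    · have : Continuous fun r : ℝ => (r - s).toNNReal := by fun_prop
      simpa using (this.tendsto s).mono_left nhdsWithin_le_nhds
    · filter_upwards [self_mem_nhdsWithin] with r hr
      exact Real.toNNReal_pos.2 (sub_pos.2 hr)
  refine ((((π.comp (T s.toNNReal)).continuous.tendsto y).comp h).comp hlim).congr' ?_
  filter_upwards [self_mem_nhdsWithin] with r hr
  have hr : s < r := hr
  have e : r.toNNReal = s.toNNReal + (r - s).toNNReal := by
    rw [← Real.toNNReal_add hs (by linarith)]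
    congr 1
    ring
  have e' : (((r - s).toNNReal : ℝ) : ℂ)⁻¹ = ((r - s : ℝ)⁻¹ : ℝ) := by
    rw [Real.coe_toNNReal _ (by linarith)]
    push_cast
    rfl
  simp only [Function.comp, slope_def_module, ContinuousLinearMap.comp_apply, map_smul, map_sub]
  rw [e', Complex.coe_smul, e, hT.apply_add]

theorem IsSemigroup.orbit_add (hT : IsSemigroup T) (t : ℝ≥0) {s : ℝ} (hs : 0 ≤ s) (x : X) :
    T (s + t).toNNReal x = T t (T s.toNNReal x) := by
  rw [Real.toNNReal_add hs t.coe_nonneg, Real.toNNReal_coe, add_comm, hT.apply_add]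

theorem continuous_exp_smul_orbit (hcont : IsStronglyContinuous T) (ρ : ℝ≥0) (n : ℤ) (x : X) :
    Continuous fun s : ℝ => Complex.exp (-freq ρ n * s) • π (T s.toNNReal x) := by
  have := π.continuous.comp (hcont.continuous_orbit x)
  exact Continuous.smul (by fun_prop) this

/-- Integration by parts with right derivatives only; the boundary terms cancel by periodicity. -/
theorem IsSemigroup.integral_exp_smul_generator [CompleteSpace Y] (hT : IsSemigroup T)
    (hcont : IsStronglyContinuous T) {ρ : ℝ≥0} (hρ : 0 < ρ)
    (hTρ : T ρ = ContinuousLinearMap.id ℂ X) {x y : X} (h : HasRightDerivZero T x y) (n : ℤ) :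
    ∫ s in (0 : ℝ)..ρ, Complex.exp (-freq ρ n * s) • π (T s.toNNReal y)
      = freq ρ n • ∫ s in (0 : ℝ)..ρ, Complex.exp (-freq ρ n * s) • π (T s.toNNReal x) := by
  have cx := continuous_exp_smul_orbit π hcont ρ n x
  have cy := continuous_exp_smul_orbit π hcont ρ n y
  have key := intervalIntegral.integral_eq_sub_of_hasDeriv_right_of_le (a := 0) (b := ρ)
    (f := fun s : ℝ => Complex.exp (-freq ρ n * s) • π (T s.toNNReal x))
    (f' := fun s : ℝ => Complex.exp (-freq ρ n * s) • π (T s.toNNReal y)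
      - freq ρ n • Complex.exp (-freq ρ n * s) • π (T s.toNNReal x))
    ρ.coe_nonneg cx.continuousOn ?_ ((cy.sub (cx.const_smul _)).intervalIntegrable _ _)
  · rw [intervalIntegral.integral_sub (cy.intervalIntegrable _ _)
      (by exact (cx.const_smul (freq ρ n)).intervalIntegrable _ _),
      intervalIntegral.integral_smul, exp_neg_freq_mul_period hρ] at key
    simpa [hTρ, hT.map_zero, sub_eq_zero] using key
  · intro s hs
    have hexp : HasDerivAt (fun s : ℝ => Complex.exp (-freq ρ n * s))
        (Complex.exp (-freq ρ n * s) * -freq ρ n) s := by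
      have := ((hasDerivAt_id (s : ℂ)).const_mul (-freq ρ n)).cexp.comp_ofReal
      simpa using this
    refine (hexp.hasDerivWithinAt.smul (hT.hasDerivWithinAt_orbit π h hs.1.le)).congr_deriv ?_
    rw [sub_eq_add_neg, ← neg_smul, smul_smul, mul_comm (-freq ρ n) (Complex.exp _)]

theorem IsSemigroup.integral_exp_smul_shift (hT : IsSemigroup T)
    (hcont : IsStronglyContinuous T) {ρ : ℝ≥0} (hρ : 0 < ρ)
    (hTρ : T ρ = ContinuousLinearMap.id ℂ X) (x : X) (n : ℤ) (t : ℝ≥0) :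
    ∫ s in (0 : ℝ)..ρ, Complex.exp (-freq ρ n * s) • π (T t (T s.toNNReal x))
      = Complex.exp (freq ρ n * (t : ℝ)) •
        ∫ s in (0 : ℝ)..ρ, Complex.exp (-freq ρ n * s) • π (T s.toNNReal x) := by
  set f : ℝ → Y := fun s => Complex.exp (-freq ρ n * s) • π (T s.toNNReal x) with hf
  have cf : Continuous f := continuous_exp_smul_orbit π hcont ρ n x
  have hi : ∀ a b, IntervalIntegrable f MeasureTheory.volume a b :=
    fun a b => cf.intervalIntegrable a b
  have hshift : ∫ s in (0 : ℝ)..t, f (s + ρ) = ∫ s in (0 : ℝ)..t, f s := by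
    refine intervalIntegral.integral_congr fun s hs => ?_
    rw [Set.uIcc_of_le t.coe_nonneg] at hs
    simp only [hf]
    rw [hT.orbit_add ρ hs.1, hTρ, Complex.ofReal_add, mul_add, Complex.exp_add,
      exp_neg_freq_mul_period hρ, mul_one]
    rfl
  have hleft : ∫ s in (0 : ℝ)..ρ, Complex.exp (-freq ρ n * s) • π (T t (T s.toNNReal x))
      = Complex.exp (freq ρ n * (t : ℝ)) • ∫ s in (0 : ℝ)..ρ, f (s + t) := by
    rw [← intervalIntegral.integral_smul]
    refine intervalIntegral.integral_congr fun s hs => ?_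
    rw [Set.uIcc_of_le ρ.coe_nonneg] at hs
    simp only [hf]
    rw [hT.orbit_add t hs.1, smul_smul, ← Complex.exp_add]
    congr 2
    push_cast
    ring
  rw [hleft]
  congr 1
  -- Splitting $\int_0^{\rho+t}f$ at $t$ and at $\rho$ shows that the integral over a period is
  -- translation invariant.
  rw [intervalIntegral.integral_comp_add_right] at hshift ⊢
  have h1 := intervalIntegral.integral_add_adjacent_intervals (hi 0 t) (hi t (ρ + t))
  have h2 := intervalIntegral.integral_add_adjacent_intervals (hi 0 ρ) (hi ρ (ρ + t))
  rw [zero_add] at hshift ⊢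
  rw [add_comm (t : ℝ)] at hshift
  rw [hshift, ← h1, add_comm] at h2
  exact (add_left_cancel h2).symm

end Semigroup

/-! ### The operators $P_n$ and the expansion on $D(A)$ -/

section Projections

variable {X : Type u} [AddCommGroup X] [Module ℂ X] [UniformSpace X] [IsUniformAddGroup X]
  [PolynormableSpace ℂ X]

theorem eq_of_forall_continuousLinearMap_eq [T2Space X] {x y : X}
    (h : ∀ (Y : Type u) [NormedAddCommGroup Y] [NormedSpace ℂ Y] [CompleteSpace Y]
      (π : X →L[ℂ] Y), π x = π y) : x = y := by
  by_contra hne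
  obtain ⟨q, hq⟩ := (PolynormableSpace.withSeminorms ℂ X).separating_of_T1 (x - y)
    (sub_ne_zero.2 hne)
  obtain ⟨Y, _, _, _, π, hπ⟩ := q.1.exists_continuousLinearMap_norm_eq q.2
  exact hq (by rw [← hπ, map_sub, h Y π, sub_self, norm_zero])

theorem exists_spectralProjection [T2Space X] [ContinuousSMul ℂ X] [QuasiCompleteSpace ℂ X]
    {T : ℝ≥0 → X →L[ℂ] X} (hcont : IsStronglyContinuous T) (hequi : IsLocallyEquicontinuous T)
    {ρ : ℝ≥0} (hρ : 0 < ρ) (n : ℤ) :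
    ∃ P : X →L[ℂ] X, ∀ x : X, (∃ I : X, HasRiemannIntegral
        (fun s : ℝ => Complex.exp (-freq ρ n * (s : ℂ)) • T s.toNNReal x) 0 ρ I ∧
        P x = (((ρ : ℝ) : ℂ)⁻¹) • I) ∧
      ∀ (Y : Type u) [NormedAddCommGroup Y] [NormedSpace ℂ Y] [CompleteSpace Y] (π : X →L[ℂ] Y),
        π (P x) = ((ρ : ℝ) : ℂ)⁻¹ •
          ∫ s in (0 : ℝ)..ρ, Complex.exp (-freq ρ n * s) • π (T s.toNNReal x) := by
  have hex : ∀ x : X, ∃ I : X, HasRiemannIntegral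
      (fun s : ℝ => Complex.exp (-freq ρ n * (s : ℂ)) • T s.toNNReal x) 0 ρ I ∧
      ∀ (Y : Type u) [NormedAddCommGroup Y] [NormedSpace ℂ Y] [CompleteSpace Y] (π : X →L[ℂ] Y),
        π I = ∫ s in (0 : ℝ)..ρ, Complex.exp (-freq ρ n * s) • π (T s.toNNReal x) := by
    intro x
    have hc : Continuous fun s : ℝ => Complex.exp (-freq ρ n * (s : ℂ)) • T s.toNNReal x :=
      Continuous.smul (by fun_prop) (hcont.continuous_orbit x)
    obtain ⟨I, hI, hπ⟩ := exists_hasRiemannIntegral (f := fun s : ℝ =>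
      Complex.exp (-freq ρ n * (s : ℂ)) • T s.toNNReal x) ρ.coe_nonneg hc.continuousOn
    exact ⟨I, hI, fun Y _ _ _ π => by simpa only [map_smul] using hπ Y π⟩
  choose I hI hπI using hex
  let L : X →ₗ[ℂ] X :=
    { toFun := fun x => ((ρ : ℝ) : ℂ)⁻¹ • I x
      map_add' := fun x y => by
        rw [← smul_add]
        congr 1
        refine eq_of_forall_continuousLinearMap_eq fun Y _ _ _ π => ?_
        have cx := continuous_exp_smul_orbit π hcont ρ n x
        have cy := continuous_exp_smul_orbit π hcont ρ n y
        rw [map_add, hπI, hπI, hπI, ← intervalIntegral.integral_add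
          (cx.intervalIntegrable _ _) (cy.intervalIntegrable _ _)]
        simp only [map_add, smul_add]
      map_smul' := fun c x => by
        rw [RingHom.id_apply, smul_comm]
        congr 1
        refine eq_of_forall_continuousLinearMap_eq fun Y _ _ _ π => ?_
        rw [map_smul, hπI, hπI, ← intervalIntegral.integral_smul]
        simp only [map_smul, smul_comm c] }
  have hL : Continuous L := by
    refine WithSeminorms.continuous_of_continuous_comp
      (PolynormableSpace.withSeminorms ℂ X) L fun q => ?_
    obtain ⟨Y, _, _, _, π, hπ⟩ := q.1.exists_continuousLinearMap_norm_eq q.2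
    obtain ⟨p, hp, C, hC, hTp⟩ := hequi q.1 q.2 ρ
    -- The exponential has modulus $1$, and the interval length cancels the factor $1/\rho$.
    have hle : ∀ x, q.1 (L x) ≤ C * p x := by
      intro x
      have hρ' : (0 : ℝ) < ρ := hρ
      have hb := intervalIntegral.norm_integral_le_of_norm_le_const (a := 0) (b := (ρ : ℝ))
        (C := C * p x)
        (f := fun s : ℝ => Complex.exp (-freq ρ n * s) • π (T s.toNNReal x)) fun s hs => by
          rw [Set.uIoc_of_le ρ.coe_nonneg] at hs
          rw [norm_smul, norm_exp_neg_freq_mul, one_mul, hπ]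
          exact hTp _ (Real.toNNReal_le_iff_le_coe.2 hs.2) x
      change q.1 (((ρ : ℝ) : ℂ)⁻¹ • I x) ≤ C * p x
      rw [map_smul_eq_mul, ← hπ, hπI, norm_inv, Complex.norm_real, Real.norm_of_nonneg ρ.coe_nonneg,
        inv_mul_le_iff₀ hρ']
      rw [sub_zero, abs_of_pos hρ'] at hb
      linarith
    refine Seminorm.continuous_of_le (q := Real.toNNReal C • p) ?_ fun x => ?_
    · exact hp.const_smul (Real.toNNReal C)
    · exact (hle x).trans_eq (by
        rw [smul_apply, NNReal.smul_def, Real.coe_toNNReal C hC, smul_eq_mul])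
  exact ⟨⟨L, hL⟩, fun x => ⟨⟨I x, hI x, rfl⟩, fun Y _ _ _ π => by
    rw [← hπI, ← map_smul]; rfl⟩⟩

theorem IsSemigroup.hasSum_spectralProjection {T : ℝ≥0 → X →L[ℂ] X} (hT : IsSemigroup T)
    (hcont : IsStronglyContinuous T) {ρ : ℝ≥0} (hρ : 0 < ρ)
    (hTρ : T ρ = ContinuousLinearMap.id ℂ X) {P : ℤ → X →L[ℂ] X}
    (hP : ∀ (n : ℤ) (x : X) (Y : Type u) [NormedAddCommGroup Y] [NormedSpace ℂ Y]
      [CompleteSpace Y] (π : X →L[ℂ] Y), π (P n x) = ((ρ : ℝ) : ℂ)⁻¹ •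
        ∫ s in (0 : ℝ)..ρ, Complex.exp (-freq ρ n * s) • π (T s.toNNReal x))
    {x y : X} (h : HasRightDerivZero T x y) : HasSum (fun n => P n x) x := by
  have hρ' : (0 : ℝ) < ρ := hρ
  change Tendsto _ _ _
  rw [(PolynormableSpace.withSeminorms ℂ X).tendsto_nhds]
  intro q ε hε
  obtain ⟨Y, _, _, _, π, hπ⟩ := q.1.exists_continuousLinearMap_norm_eq q.2
  have cx : Continuous fun s : ℝ => π (T s.toNNReal x) :=
    π.continuous.comp (hcont.continuous_orbit x)
  have cy : Continuous fun s : ℝ => π (T s.toNNReal y) :=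
    π.continuous.comp (hcont.continuous_orbit y)
  obtain ⟨M, hM⟩ := (isCompact_Icc (a := (0 : ℝ)) (b := ρ)).exists_bound_of_continuousOn
    cy.continuousOn
  have hM0 : 0 ≤ M := (norm_nonneg _).trans (hM 0 ⟨le_rfl, ρ.coe_nonneg⟩)
  set η : ℝ := ε / (M + 1)
  have hη : 0 < η := by positivity
  obtain ⟨F₀, hF₀⟩ := summable_iff_vanishing_norm.1 (summable_norm_freq_inv_sq ρ) (η ^ 2)
    (by positivity)
  -- Index $0$ must lie in $F$: since $\mu_0=0$, its coefficient is not controlled by that of $Ax$.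
  filter_upwards [eventually_ge_atTop (insert 0 F₀)] with F hF
  have hF0 : (0 : ℤ) ∈ F := hF (Finset.mem_insert_self _ _)
  have htail : ∀ G : Finset ℤ, Disjoint G F → ∑ n ∈ G, ‖freq ρ n‖⁻¹ ^ 2 ≤ η ^ 2 := fun G hG =>
    (le_abs_self _).trans (hF₀ G (hG.mono_right ((Finset.subset_insert _ _).trans hF))).le
  have hbound : ‖π (x - ∑ n ∈ F, P n x)‖ ≤ η * M := by
    -- Hahn–Banach reduces the norm in $Y$ to scalar Fourier series, with one $F$ for all $\ell$.
    refine NormedSpace.norm_le_dual_bound ℂ _ (by positivity) fun ℓ => ?_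
    have hcoeff : ∀ (z : X) (n : ℤ),
        fourierCoeffOn hρ' (fun s => ℓ (π (T s.toNNReal z))) n = ℓ (π (P n z)) := by
      intro z n
      have := ℓ.intervalIntegral_comp_comm
        ((continuous_exp_smul_orbit π hcont ρ n z).intervalIntegrable
          (μ := MeasureTheory.volume) 0 ρ)
      rw [fourierCoeffOn_eq_freq, hP, map_smul, ← this]
      simp only [map_smul]
    have := norm_sub_sum_fourierCoeffOn_le hρ' (g := fun s => ℓ (π (T s.toNNReal x)))
      (h := fun s => ℓ (π (T s.toNNReal y))) (μ := freq ρ) (M := ‖ℓ‖ * M)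
      (ℓ.continuous.comp cx).continuousOn (ℓ.continuous.comp cy).continuousOn
      (by simp [hT.map_zero, hTρ])
      (fun n => by
        rw [hcoeff, hcoeff, hP, hP, hT.integral_exp_smul_generator π hcont hρ hTρ h, smul_comm,
          map_smul, smul_eq_mul])
      (fun n hn => freq_ne_zero hρ hn)
      (fun s hs => (ℓ.le_opNorm _).trans (mul_le_mul_of_nonneg_left (hM s hs) (norm_nonneg _)))
      (by positivity) hF0 hη.le htail
    simp only [hcoeff, Real.toNNReal_zero, hT.map_zero, ContinuousLinearMap.id_apply,
      ← map_sum, ← map_sub] at this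
    linarith
  rw [map_sub_rev, ← hπ]
  refine hbound.trans_lt ?_
  rw [div_mul_eq_mul_div, div_lt_iff₀ (by linarith)]
  nlinarith

end Projections

end OpSemigroup

theorem mainTheorem9 {X : Type*} [AddCommGroup X] [Module ℂ X] [UniformSpace X]
    [IsUniformAddGroup X] [ContinuousSMul ℂ X] [LocallyConvexSpace ℝ X] [T2Space X]
    [QuasiCompleteSpace ℂ X]
    (T : ℝ≥0 → X →L[ℂ] X) (hT : OpSemigroup.IsSemigroup T)
    (hcont : OpSemigroup.IsStronglyContinuous T)
    (hequi : OpSemigroup.IsLocallyEquicontinuous T)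
    (hper : OpSemigroup.IsPeriodic T)
    (ρ : ℝ≥0) (hρ : OpSemigroup.period T = ρ) (hρ_pos : 0 < ρ) :
    ∃ P : ℤ → X →L[ℂ] X,
      (∀ (n : ℤ) (x : X), ∃ I : X,
        OpSemigroup.HasRiemannIntegral
          (fun s : ℝ => Complex.exp (-OpSemigroup.freq ρ n * (s : ℂ)) • T s.toNNReal x) 0 ρ I ∧
        P n x = (((ρ : ℝ) : ℂ)⁻¹) • I) ∧
      (∀ x ∈ (OpSemigroup.generator T).domain, HasSum (fun n : ℤ => P n x) x) ∧
      (∀ x ∈ (OpSemigroup.generator T).domain, ∀ t : ℝ≥0,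
        HasSum (fun n : ℤ => Complex.exp (OpSemigroup.freq ρ n * ((t : ℝ) : ℂ)) • P n x)
          (T t x)) ∧
      (∀ x : (OpSemigroup.generator T).domain,
        OpSemigroup.generator T x ∈ (OpSemigroup.generator T).domain →
        HasSum (fun n : ℤ => OpSemigroup.freq ρ n • P n (x : X)) (OpSemigroup.generator T x)) := by
  have := LocallyConvexSpace.polynormableSpace_complex X
  have hTρ := OpSemigroup.apply_period_eq_id hcont hper
  rw [hρ] at hTρ
  choose P hPI using fun n => OpSemigroup.exists_spectralProjection hcont hequi hρ_pos n
  have hP := fun n x => (hPI n x).2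
  have hsum : ∀ x ∈ (OpSemigroup.generator T).domain, HasSum (fun n : ℤ => P n x) x :=
    fun x ⟨_, hy⟩ => hT.hasSum_spectralProjection hcont hρ_pos hTρ hP hy
  refine ⟨P, fun n x => (hPI n x).1, hsum, fun x hx t => ?_, fun x hx => ?_⟩
  · refine ((hsum x hx).mapL (T t)).congr_fun fun n => ?_
    refine OpSemigroup.eq_of_forall_continuousLinearMap_eq fun Y _ _ _ π => ?_
    -- Testing with $\pi\circ T(t)$ moves $T(t)$ inside the integral, where it becomes a shift.
    have h := hP n x Y (π.comp (T t))
    simp only [ContinuousLinearMap.comp_apply] at h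
    rw [h, map_smul, hP, hT.integral_exp_smul_shift π hcont hρ_pos hTρ, smul_comm]
  · refine (hsum _ hx).congr_fun fun n => ?_
    refine OpSemigroup.eq_of_forall_continuousLinearMap_eq fun Y _ _ _ π => ?_
    rw [map_smul, hP, hP, hT.integral_exp_smul_generator π hcont hρ_pos hTρ
      (OpSemigroup.generator_spec T x), smul_comm]
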